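/- Let $\{\alpha_n\}_{n\ge 0}$ be a sequence of complex numbers and $N\ge 1$ an integer such that $|\alpha_n|\neq 1$ for $0\le n\le N-1$ and $|\alpha_n|<1$ for $n\ge N$. For a polynomial $P$ regarded as having degree at most $n$, write $P^*(z)=z^n\,\overline{P(1/\overline z)}$. Let the monic polynomials $\Phi_n$ be defined by $\Phi_0=1$ and $\Phi_{n+1}(z)=z\Phi_n(z)-\overline{\alpha_n}\,\Phi_n^*(z)$ (with $\Phi_n^*$ taken in degree $n$), and let the Wall polynomials be defined by $A_0=\alpha_0$, $B_0=1$, $A_{n+1}(z)=A_n(z)+\alpha_{n+1}zB_n^*(z)$, $B_{n+1}(z)=B_n(z)+\alpha_{n+1}zA_n^*(z)$ (with $A_n^*,B_n^*$ taken in degree $n$). Put $\omega_{N-1}=\prod_{j=0}^{N-1}(1-|\alpha_j|^2)$, a real number which may be negative. Let $f_N$ be the Schur function corresponding to $\{\alpha_n\}_{n\ge N}$, that is, the first term of a sequence $f_N,f_{N+1},\dots$ of analytic functions from the open unit disk $\mathbb D$ to its closure with $$f_n(z)=\frac{\alpha_n+zf_{n+1}(z)}{1+\overline{\alpha_n}\,zf_{n+1}(z)},\qquad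 z\in\mathbb D,\ n\ge N,$$ and define, in $\mathbb D$, $$f(z)=\frac{A_{N-1}(z)+zB_{N-1}^*(z)f_N(z)}{B_{N-1}(z)+zA_{N-1}^*(z)f_N(z)},\qquad F(z)=\frac{1+zf(z)}{1-zf(z)}.$$ Then for Lebesgue almost every $z$ on the unit circle the radial limits $f_N(z)=\lim_{r\uparrow1}f_N(rz)$ and $F(z)=\lim_{r\uparrow1}F(rz)$ exist (and are finite), $\Phi_N^*(z)-z\Phi_N(z)f_N(z)\neq0$, and $$\operatorname{Re}F(z)=\omega_{N-1}\,\frac{1-|f_N(z)|^2}{|\Phi_N^*(z)-z\Phi_N(z)f_N(z)|^2}.$$ -/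

import Mathlib

open Polynomial

noncomputable section

namespace OPUC

/-- The reversed polynomial `P^*(z) = z ^ n * conj (P (1 / conj z))`, for `P` of degree at most `n`:
conjugate the coefficients and reverse their order with respect to the degree bound `n`. -/
def revPoly (n : ℕ) (P : ℂ[X]) : ℂ[X] := (P.map (starRingEnd ℂ)).reflect n

/-- The monic polynomials generated by the Szego recurrence
`Φ_{n+1} = z Φ_n - conj (α_n) Φ_n^*`, `Φ_0 = 1`. -/
def Phi (α : ℕ → ℂ) : ℕ → ℂ[X]
  | 0 => 1
  | n + 1 => X * Phi α n - C (starRingEnd ℂ (α n)) * revPoly n (Phi α n)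

/-- The pair `(A_n, B_n)` of Wall polynomials: `A_0 = α_0`, `B_0 = 1`,
`A_{n+1} = A_n + α_{n+1} z B_n^*`, `B_{n+1} = B_n + α_{n+1} z A_n^*`. These are the coefficients of
the composition of the first `n + 1` Schur steps
`w ↦ (α_j + z w) / (1 + conj (α_j) z w)`, `j = 0, …, n`, which is
`w ↦ (A_n + z B_n^* w) / (B_n + z A_n^* w)`. -/
def wall (α : ℕ → ℂ) : ℕ → ℂ[X] × ℂ[X]
  | 0 => (C (α 0), 1)
  | n + 1 =>
    ((wall α n).1 + C (α (n + 1)) * X * revPoly n (wall α n).2,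
     (wall α n).2 + C (α (n + 1)) * X * revPoly n (wall α n).1)

/-- The Wall polynomial `A_n`. -/
def wallA (α : ℕ → ℂ) (n : ℕ) : ℂ[X] := (wall α n).1

/-- The Wall polynomial `B_n`. -/
def wallB (α : ℕ → ℂ) (n : ℕ) : ℂ[X] := (wall α n).2

/-- `ω_n = ∏_{j = 0}^{n} (1 - |α_j| ^ 2)`. -/
def omega (α : ℕ → ℂ) (n : ℕ) : ℝ := ∏ j ∈ Finset.range (n + 1), (1 - ‖α j‖ ^ 2)

/-- A Schur function: analytic on the open unit disk, with values in the closed unit disk. (Its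
values outside of the open disk are irrelevant.) -/
def IsSchur (f : ℂ → ℂ) : Prop :=
  DifferentiableOn ℂ f (Metric.ball 0 1) ∧ ∀ z ∈ Metric.ball (0 : ℂ) 1, ‖f z‖ ≤ 1

/-- `f` is the Schur function corresponding to the sequence `β`: it starts a sequence
of Schur functions `g_0 = f, g_1, g_2, …` linked by the Schur algorithm
`g_n = (β_n + z g_{n+1}) / (1 + conj (β_n) z g_{n+1})` on the open unit disk. -/
def IsSchurFunctionOf (β : ℕ → ℂ) (f : ℂ → ℂ) : Prop :=
  ∃ g : ℕ → ℂ → ℂ, g 0 = f ∧ (∀ n, IsSchur (g n)) ∧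
    ∀ n, ∀ z ∈ Metric.ball (0 : ℂ) 1,
      g n z = (β n + z * g (n + 1) z) / (1 + starRingEnd ℂ (β n) * z * g (n + 1) z)

/-- The function `f = (A_{N-1} + z B_{N-1}^* f_N) / (B_{N-1} + z A_{N-1}^* f_N)`, for `N ≥ 1`. -/
def wallRepr (α : ℕ → ℂ) (N : ℕ) (fN : ℂ → ℂ) (z : ℂ) : ℂ :=
  ((wallA α (N - 1)).eval z + z * (revPoly (N - 1) (wallB α (N - 1))).eval z * fN z) /
    ((wallB α (N - 1)).eval z + z * (revPoly (N - 1) (wallA α (N - 1))).eval z * fN z)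

/-- `F(z) = (1 + z f(z)) / (1 - z f(z))`. -/
def caratheodory (f : ℂ → ℂ) (z : ℂ) : ℂ := (1 + z * f z) / (1 - z * f z)

/-- `g` has the radial boundary value `w` at the point `z` of the unit circle. -/
def HasRadialLimit (g : ℂ → ℂ) (z w : ℂ) : Prop :=
  Filter.Tendsto (fun r : ℝ => g ((r : ℂ) * z)) (nhdsWithin 1 (Set.Iio 1)) (nhds w)

end OPUC

end

/-! Write `f = A / D`, with `A`, `D` the numerator and denominator of the Wall representation. Since
`Φ_N = z B_{N-1}^* - A_{N-1}^*` and `Φ_N^* = B_{N-1} - z A_{N-1}`, one gets `D - z A = Φ_N^* - z Φ_N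
f_N`. Hence `F = (D + z A) / (D - z A)`, and on the circle `Re F = (|D|² - |A|²) / |D - z A|²` with
`|D|² - |A|² = ω_{N-1} (1 - |f_N|²)`.

Two facts justify this at almost every boundary point. Radial limits of `f_N` exist by Fatou's
theorem (`ae_exists_hasRadialLimit`). The limits of `D` and `D - z A` are nonzero by
`ae_not_hasRadialLimit_zero`, as both functions are bounded, analytic and equal to 1 at the origin.
-/

section BoundaryValues

open Metric Complex Filter Topology MeasureTheory Asymptotics NNReal

/-! ### Fatou's theorem through a Lipschitz primitive -/

/-- The Herglotz–Riesz average of `H` is `2 H(v) - H(0)`; differentiating it in `v` gives the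
kernel. -/
theorem DiffContOnCl.deriv_eq_circleAverage {H : ℂ → ℂ} (hH : DiffContOnCl ℂ H (ball 0 1))
    {w : ℂ} (hw : w ∈ ball (0 : ℂ) 1) :
    deriv H w = Real.circleAverage (fun ζ => ζ / (ζ - w) ^ 2 * H ζ) 0 1 := by
  have hc : ContinuousOn H (sphere 0 1) := hH.continuousOn_ball.mono sphere_subset_closedBall
  have hci : CircleIntegrable H 0 1 := hc.circleIntegrable zero_le_one
  have key : ∀ v ∈ ball (0 : ℂ) 1,
      Real.circleAverage (fun ζ ↦ herglotzRieszKernel 0 v ζ • H ζ) 0 1 = 2 * H v - H 0 := by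
    intro v hv
    have h1 : Real.circleAverage (fun ζ ↦ (ζ / (ζ - v)) • H ζ) 0 1 = H v := by
      have := DiffContOnCl.circleAverage_smul_div (c := 0) (R := 1) (w := v) (f := H)
        (by simpa using hH) (by simpa using hv)
      simpa using this
    have h0 : Real.circleAverage H 0 1 = H 0 := by
      have := DiffContOnCl.circleAverage (c := 0) (R := 1) (f := H) (by simpa using hH)
      simpa using this
    have hne : ∀ ζ ∈ sphere (0 : ℂ) 1, ζ - v ≠ 0 := fun ζ hζ h =>
      sphere_disjoint_ball.ne_of_mem hζ hv (sub_eq_zero.mp h)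
    have i1 : CircleIntegrable (fun ζ ↦ (2 : ℂ) • ((ζ / (ζ - v)) • H ζ)) 0 1 := by
      apply ContinuousOn.circleIntegrable zero_le_one
      have : ContinuousOn (fun ζ : ℂ => ζ / (ζ - v)) (sphere 0 1) :=
        continuousOn_id.div (continuousOn_id.sub continuousOn_const) hne
      exact (this.smul hc).const_smul (2 : ℂ)
    rw [← h1, ← h0, ← smul_eq_mul, ← Real.circleAverage_fun_smul, ← Real.circleAverage_fun_sub i1 hci]
    apply Real.circleAverage_congr_sphere
    intro ζ hζ
    have := hne ζ (by simpa using hζ)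
    simp only [herglotzRieszKernel_def, smul_eq_mul, sub_zero]
    field_simp
    ring
  have d1 := hasDerivAt_circleAverage_herglotzRieszKernel_smul hci hw
  have d2 : HasDerivAt (fun v => Real.circleAverage (fun ζ ↦ herglotzRieszKernel 0 v ζ • H ζ) 0 1)
      (2 * deriv H w) w := by
    have := (((hH.differentiableAt isOpen_ball hw).hasDerivAt).const_mul 2).sub_const (H 0)
    refine this.congr_of_eventuallyEq ?_
    filter_upwards [isOpen_ball.mem_nhds hw] with v hv using key v hv
  have h := d2.unique d1
  have h2 : Real.circleAverage (fun ζ ↦ (2 * ζ / (ζ - w) ^ 2) • H ζ) 0 1 =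
      2 * Real.circleAverage (fun ζ => ζ / (ζ - w) ^ 2 * H ζ) 0 1 := by
    rw [← smul_eq_mul, ← Real.circleAverage_fun_smul]
    congr 1
    ext ζ
    simp only [smul_eq_mul]
    ring
  rw [h2] at h
  exact mul_left_cancel₀ two_ne_zero h

/-- Allows the kernel at the reflected point `z / r` to be subtracted from the one at `r z` at no
cost, which produces Poisson-type decay. -/
theorem DiffContOnCl.circleAverage_exterior_eq_zero {H : ℂ → ℂ} (hH : DiffContOnCl ℂ H (ball 0 1))
    {v : ℂ} (hv : 1 < ‖v‖) :
    Real.circleAverage (fun ζ => ζ / (ζ - v) ^ 2 * H ζ) 0 1 = 0 := by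
  have hne : ∀ ζ ∈ closedBall (0 : ℂ) 1, (ζ - v) ^ 2 ≠ 0 := by
    intro ζ hζ h
    have : ζ = v := sub_eq_zero.mp (by simpa using h)
    subst this
    simp at hζ
    linarith
  have hd : ∀ ζ ∈ ball (0 : ℂ) 1, DifferentiableAt ℂ (fun ζ => ((ζ - v) ^ 2)⁻¹ * H ζ) ζ :=
    fun ζ hζ => DifferentiableAt.mul
      (DifferentiableAt.inv (by fun_prop) (hne ζ (ball_subset_closedBall hζ)))
      (hH.differentiableAt isOpen_ball hζ)
  have hcont : ContinuousOn (fun ζ => ((ζ - v) ^ 2)⁻¹ * H ζ) (closedBall 0 1) :=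
    ContinuousOn.mul (ContinuousOn.inv₀ (by fun_prop) hne) hH.continuousOn_ball
  have := circleIntegral_eq_zero_of_differentiable_on_off_countable zero_le_one
    Set.countable_empty hcont (fun ζ hζ => hd ζ hζ.1)
  rw [Real.circleAverage_eq_circleIntegral one_ne_zero]
  rw [smul_eq_zero]
  right
  refine Eq.trans (circleIntegral.integral_congr zero_le_one ?_) this
  intro ζ hζ
  have : ζ ≠ 0 := by
    rintro rfl
    simp at hζ
  simp only [smul_eq_mul, sub_zero]
  field_simp

theorem norm_sub_reflection {ζ z : ℂ} (hζ : ‖ζ‖ = 1) (hz : ‖z‖ = 1) {r : ℝ} (hr : 0 < r) :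
    ‖ζ - z / r‖ = ‖ζ - r * z‖ / r := by
  have h1 : ζ * starRingEnd ℂ ζ = 1 := by rw [mul_conj, normSq_eq_norm_sq, hζ]; simp
  have h2 : z * starRingEnd ℂ z = 1 := by rw [mul_conj, normSq_eq_norm_sq, hz]; simp
  have h3 : (r : ℂ) ≠ 0 := by exact_mod_cast hr.ne'
  have : r * (ζ - z / r) = -(ζ * z * starRingEnd ℂ (ζ - r * z)) := by
    simp only [map_sub, map_mul, conj_ofReal]
    field_simp
    linear_combination z * h1 - r * ζ * h2
  have h := congrArg norm this
  simp only [norm_mul, norm_neg, hζ, hz, RCLike.norm_conj, norm_real, Real.norm_of_nonneg hr.le] at h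
  rw [eq_div_iff hr.ne', mul_comm, h]
  ring

theorem norm_circleAverage_le_of_norm_le {f : ℂ → ℂ} {g : ℂ → ℝ} {c : ℂ} {R : ℝ}
    (hg : CircleIntegrable g c R) (h : ∀ ζ ∈ sphere c |R|, ‖f ζ‖ ≤ g ζ) :
    ‖Real.circleAverage f c R‖ ≤ Real.circleAverage g c R := by
  rw [Real.circleAverage_def, Real.circleAverage_def, norm_smul, smul_eq_mul, Real.norm_of_nonneg (by positivity)]
  gcongr
  exact intervalIntegral.norm_integral_le_of_norm_le Real.two_pi_pos.le
    (ae_of_all _ fun θ _ => h _ (circleMap_mem_sphere' c R θ)) hg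

/-- The kernel difference carries the factor `(1 - r²)(ζ - z)(ζ + z)`. With `|ζ - z| ≤ 2 |ζ - r z|`,
the `ε` part is controlled by the Poisson kernel, of average 1, and the `D` part vanishes as `r →
1`. -/
theorem norm_derivPoissonKernel_mul_le {ζ z : ℂ} (hζ : ‖ζ‖ = 1) (hz : ‖z‖ = 1) {r : ℝ}
    (hr : 0 < r) (hr1 : r < 1) {h : ℂ} {ε D : ℝ} (hε : 0 ≤ ε) (hD : 0 ≤ D)
    (hh : ‖h‖ ≤ (ε + D * ‖ζ - z‖ ^ 2) * ‖ζ - z‖) :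
    ‖(r * z) * (ζ / (ζ - r * z) ^ 2 * h) - (z / r) * (ζ / (ζ - z / r) ^ 2 * h)‖ ≤
      8 * ε * poissonKernel 0 (r * z) ζ + 32 * D * (1 - r ^ 2) := by
  have hrC : (r : ℂ) ≠ 0 := by exact_mod_cast hr.ne'
  set d := ‖ζ - r * z‖ with hd
  set s := ‖ζ - z‖ with hs
  have hs0 : 0 ≤ s := norm_nonneg _
  have hd1 : 1 - r ≤ d := by
    have := norm_sub_norm_le ζ (r * z)
    simpa [hζ, hz, abs_of_pos hr] using this
  have hd0 : 0 < d := by linarith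
  have hsd : s ≤ 2 * d := by
    have h1 : ζ - z = (ζ - r * z) + ((r - 1 : ℝ) : ℂ) * z := by push_cast; ring
    have h2 := norm_add_le (ζ - r * z) (((r - 1 : ℝ) : ℂ) * z)
    rw [← h1, norm_mul, hz, norm_real, Real.norm_eq_abs, abs_of_neg (by linarith)] at h2
    linarith
  have hr2 : 0 < 1 - r ^ 2 := by nlinarith
  have hne1 : ζ - r * z ≠ 0 := norm_pos_iff.mp hd0
  have hne2 : ζ - z / r ≠ 0 := by
    rw [← norm_pos_iff, norm_sub_reflection hζ hz hr]; positivity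
  have e : (r * z) * (ζ / (ζ - r * z) ^ 2 * h) - (z / r) * (ζ / (ζ - z / r) ^ 2 * h) =
      -(ζ * z * ((1 - r ^ 2 : ℝ) / r : ℂ) * ((ζ - z) * (ζ + z)) * h) /
        ((ζ - r * z) ^ 2 * (ζ - z / r) ^ 2) := by
    rw [eq_div_iff (by positivity)]
    have a1 : (r * z) * (ζ / (ζ - r * z) ^ 2 * h) * ((ζ - r * z) ^ 2 * (ζ - z / r) ^ 2) =
      r * z * ζ * h * (ζ - z / r) ^ 2 := by field_simp
    have a2 : (z / r) * (ζ / (ζ - z / r) ^ 2 * h) * ((ζ - r * z) ^ 2 * (ζ - z / r) ^ 2) =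
      z / r * ζ * h * (ζ - r * z) ^ 2 := by
        have : (z / r) * (ζ / (ζ - z / r) ^ 2 * h) * ((ζ - r * z) ^ 2 * (ζ - z / r) ^ 2) =
          (z / r) * ζ * h * (ζ - r * z) ^ 2 * ((ζ - z / r) ^ 2 / (ζ - z / r) ^ 2) := by ring
        rw [this, div_self (by positivity), mul_one]
    rw [sub_mul, a1, a2]
    push_cast
    field_simp
    ring
  have hadd : ‖ζ + z‖ ≤ 2 := (norm_add_le _ _).trans (by rw [hζ, hz]; norm_num)
  have hP : poissonKernel 0 (r * z) ζ = (1 - r ^ 2) / d ^ 2 := by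
    simp [poissonKernel_def, hζ, hz, hd]
  rw [e, norm_div, norm_neg, hP]
  simp only [norm_mul, norm_pow, hζ, hz, norm_div, norm_real, Real.norm_of_nonneg hr2.le,
    Real.norm_of_nonneg hr.le, norm_sub_reflection hζ hz hr, ← hd, ← hs, one_mul]
  have hs2 : s ^ 2 ≤ 4 * d ^ 2 := by nlinarith
  calc (1 - r ^ 2) / r * (s * ‖ζ + z‖) * ‖h‖ / (d ^ 2 * (d / r) ^ 2)
      ≤ (1 - r ^ 2) / r * (s * 2) * ((ε + D * s ^ 2) * s) / (d ^ 2 * (d / r) ^ 2) := by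
        gcongr
    _ = r * (2 * (1 - r ^ 2) * (ε + D * s ^ 2) * s ^ 2 / d ^ 4) := by field_simp
    _ ≤ 1 * (2 * (1 - r ^ 2) * (ε + D * (4 * d ^ 2)) * (4 * d ^ 2) / d ^ 4) := by
        gcongr
    _ = _ := by field_simp; ring

theorem norm_deriv_radial_le {H : ℂ → ℂ} (hH : DiffContOnCl ℂ H (ball 0 1)) {z : ℂ} (hz : ‖z‖ = 1)
    {r ε D : ℝ} (hr : 0 < r) (hr1 : r < 1) (hε : 0 ≤ ε) (hD : 0 ≤ D)
    (hh : ∀ ζ ∈ sphere (0 : ℂ) 1, ‖H ζ‖ ≤ (ε + D * ‖ζ - z‖ ^ 2) * ‖ζ - z‖) :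
    r * ‖deriv H (r * z)‖ ≤ 8 * ε + 32 * D * (1 - r ^ 2) := by
  have hw : (r * z : ℂ) ∈ ball (0 : ℂ) 1 := by simp [hz, abs_of_pos hr, hr1]
  have hv : 1 < ‖z / r‖ := by
    rw [norm_div, hz, norm_real, Real.norm_of_nonneg hr.le]; exact one_lt_one_div hr hr1
  have hc : ContinuousOn H (sphere 0 1) := hH.continuousOn_ball.mono sphere_subset_closedBall
  have hi : ∀ v : ℂ, (∀ ζ ∈ sphere (0 : ℂ) 1, ζ ≠ v) → ∀ a : ℂ,
      CircleIntegrable (fun ζ => a • (ζ / (ζ - v) ^ 2 * H ζ)) 0 1 := by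
    intro v hv a
    apply ContinuousOn.circleIntegrable zero_le_one
    have : ContinuousOn (fun ζ : ℂ => ζ / (ζ - v) ^ 2) (sphere 0 1) :=
      ContinuousOn.div (by fun_prop) (by fun_prop)
        fun ζ hζ => pow_ne_zero _ (sub_ne_zero.mpr (hv ζ hζ))
    exact (this.mul hc).const_smul a
  have i1 := hi (r * z) (fun ζ hζ => sphere_disjoint_ball.ne_of_mem hζ hw) (r * z)
  have i2 := hi (z / r) (fun ζ hζ h => by subst h; simp at hζ; simp [hζ] at hv) (z / r)
  have e1 : (r * z) * deriv H (r * z) = Real.circleAverage (fun ζ =>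
      (r * z) * (ζ / (ζ - r * z) ^ 2 * H ζ) - (z / r) * (ζ / (ζ - z / r) ^ 2 * H ζ)) 0 1 := by
    have := Real.circleAverage_fun_sub i1 i2
    simp only [Real.circleAverage_fun_smul, hH.circleAverage_exterior_eq_zero hv,
      ← hH.deriv_eq_circleAverage hw] at this
    simpa using this.symm
  have hPc : ContinuousOn (poissonKernel 0 (r * z)) (sphere 0 1) := by
    rw [poissonKernel_eq_re_herglotzRieszKernel]
    have := continuousOn_herglotzRieszKernel_sphere hw
    rw [abs_one] at this
    exact continuous_re.comp_continuousOn this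
  have hP1 : Real.circleAverage (poissonKernel 0 (r * z)) 0 1 = 1 := by
    have h := DiffContOnCl.circleAverage_poissonKernel_smul (f := fun _ => (1 : ℂ)) (c := 0)
      (R := 1) diffContOnCl_const hw
    have hci : CircleIntegrable (poissonKernel 0 (r * z) • fun _ => (1 : ℂ)) 0 1 :=
      (hPc.smul continuousOn_const).circleIntegrable zero_le_one
    have h' := reCLM.circleAverage_comp_comm hci
    rw [h] at h'
    simpa [Function.comp_def] using h'
  have hg1 : CircleIntegrable (fun ζ => (8 * ε) • poissonKernel 0 (r * z) ζ) 0 1 :=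
    (hPc.const_smul (8 * ε)).circleIntegrable zero_le_one
  have hg2 : CircleIntegrable (fun _ : ℂ => 32 * D * (1 - r ^ 2)) 0 1 := by
    exact continuousOn_const.circleIntegrable zero_le_one
  have hle := norm_circleAverage_le_of_norm_le (f := fun ζ =>
      (r * z) * (ζ / (ζ - r * z) ^ 2 * H ζ) - (z / r) * (ζ / (ζ - z / r) ^ 2 * H ζ))
      (g := fun ζ => (8 * ε) • poissonKernel 0 (r * z) ζ + 32 * D * (1 - r ^ 2)) (c := 0) (R := 1)
      (hg1.add hg2)
      (fun ζ hζ => norm_derivPoissonKernel_mul_le (by simpa using hζ) hz hr hr1 hε hD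
        (hh ζ (by simpa using hζ)))
  rw [← e1, Real.circleAverage_fun_add hg1 hg2, Real.circleAverage_fun_smul, hP1,
    Real.circleAverage_const, norm_mul, norm_mul, hz, norm_real, Real.norm_of_nonneg hr.le] at hle
  simpa using hle

theorem tendsto_deriv_radial_zero {H : ℂ → ℂ} (hH : DiffContOnCl ℂ H (ball 0 1)) {z : ℂ}
    (hz : ‖z‖ = 1) {C : ℝ} (hC : ∀ ζ ∈ sphere (0 : ℂ) 1, ‖H ζ‖ ≤ C * ‖ζ - z‖)
    (ho : H =o[𝓝[sphere 0 1] z] fun ζ => ζ - z) :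
    Tendsto (fun r : ℝ => deriv H (r * z)) (𝓝[<] 1) (𝓝 0) := by
  rw [tendsto_zero_iff_norm_tendsto_zero]
  have hr1 : Tendsto (fun r : ℝ => r) (𝓝[<] 1) (𝓝 1) := tendsto_id.mono_left nhdsWithin_le_nhds
  have hpos : ∀ᶠ r : ℝ in 𝓝[<] 1, 0 < r ∧ r < 1 := by
    filter_upwards [hr1.eventually (lt_mem_nhds zero_lt_one), self_mem_nhdsWithin] with r h1 h2
      using ⟨h1, h2⟩
  suffices h : Tendsto (fun r : ℝ => r * ‖deriv H (r * z)‖) (𝓝[<] 1) (𝓝 0) by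
    have := (hr1.inv₀ one_ne_zero).mul h
    rw [mul_zero] at this
    refine this.congr' ?_
    filter_upwards [hpos] with r hr
    field_simp [hr.1.ne']
  rw [Metric.tendsto_nhds]
  intro ε hε
  -- The value `ε / 16` makes the limiting bound `8 * (ε / 16) = ε / 2`.
  obtain ⟨δ, hδ, hδ'⟩ := Metric.mem_nhdsWithin_iff.mp (ho.def (c := ε / 16) (by positivity))
  have hD : 0 ≤ |C| / δ ^ 2 := by positivity
  -- Within `δ` of `z` the little-o bound applies; farther away `|ζ - z|² / δ² ≥ 1`, so the
  -- quadratic term absorbs `C`.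
  have hh : ∀ ζ ∈ sphere (0 : ℂ) 1,
      ‖H ζ‖ ≤ (ε / 16 + |C| / δ ^ 2 * ‖ζ - z‖ ^ 2) * ‖ζ - z‖ := by
    intro ζ hζ
    rcases lt_or_ge ‖ζ - z‖ δ with h | h
    · have : ‖H ζ‖ ≤ ε / 16 * ‖ζ - z‖ := hδ' ⟨by simpa [dist_eq_norm] using h, hζ⟩
      refine this.trans ?_
      gcongr
      have : 0 ≤ |C| / δ ^ 2 * ‖ζ - z‖ ^ 2 := by positivity
      linarith
    · refine (hC ζ hζ).trans ?_
      gcongr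
      have : |C| ≤ |C| / δ ^ 2 * ‖ζ - z‖ ^ 2 := by
        rw [div_mul_eq_mul_div, le_div_iff₀ (by positivity)]
        gcongr
      have := le_abs_self C
      linarith
  have hlim : Tendsto (fun r : ℝ => 8 * (ε / 16) + 32 * (|C| / δ ^ 2) * (1 - r ^ 2)) (𝓝[<] 1)
      (𝓝 (8 * (ε / 16) + 32 * (|C| / δ ^ 2) * (1 - 1 ^ 2))) :=
    ((tendsto_const_nhds.sub (hr1.pow 2)).const_mul _).const_add _
  have hev := hlim.eventually (gt_mem_nhds (show _ < ε by linarith))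
  filter_upwards [hpos, hev] with r hr hlt
  have := norm_deriv_radial_le hH hz hr.1 hr.2 (by positivity) hD hh
  rw [dist_zero_right, Real.norm_of_nonneg (mul_nonneg hr.1.le (norm_nonneg _))]
  linarith

/-- On the circle `ζ = exp (i (θ + arg (ζ / z)))`, and `arg (ζ / z) = O(ζ - z)`. -/
theorem isLittleO_sphere_of_hasDerivAt {H : ℂ → ℂ} {θ : ℝ} {z : ℂ} (hz : z = exp (θ * I))
    (hH : H z = 0) (hd : HasDerivAt (fun t : ℝ => H (exp (t * I))) 0 θ) :
    H =o[𝓝[sphere 0 1] z] fun ζ => ζ - z := by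
  have hz0 : z ≠ 0 := hz ▸ exp_ne_zero _
  have hz1 : ‖z‖ = 1 := by rw [hz, norm_exp_ofReal_mul_I]
  have hlog : HasDerivAt (fun ζ : ℂ => log (ζ / z)) (1 / z / (z / z)) z :=
    ((hasDerivAt_id z).div_const z).clog (by simp [hz0, one_mem_slitPlane])
  have hO : (fun ζ : ℂ => arg (ζ / z)) =O[𝓝 z] fun ζ => ζ - z := by
    have := hlog.differentiableAt.isBigO_sub
    simp only [div_self hz0, log_one, sub_zero] at this
    refine IsBigO.trans (IsBigO.of_bound 1 ?_) this
    filter_upwards with ζ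
    rw [one_mul, ← log_im, Real.norm_eq_abs]
    exact abs_im_le_norm _
  have htend : Tendsto (fun ζ : ℂ => θ + arg (ζ / z)) (𝓝[sphere 0 1] z) (𝓝 θ) := by
    have h1 : ContinuousAt (fun ζ : ℂ => arg (ζ / z)) z :=
      ContinuousAt.comp (g := arg) (continuousAt_arg (by simp [hz0, one_mem_slitPlane]))
        (continuousAt_id.div_const z)
    have h2 : Tendsto (fun ζ : ℂ => arg (ζ / z)) (𝓝 z) (𝓝 0) := by
      simpa [ContinuousAt, hz0] using h1
    simpa using (h2.mono_left nhdsWithin_le_nhds).const_add θ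
  have ho := (hasDerivAt_iff_isLittleO.mp hd).comp_tendsto htend
  simp only [← hz, hH, sub_zero, smul_zero, Function.comp_def, add_sub_cancel_left] at ho
  refine (ho.trans_isBigO (hO.mono nhdsWithin_le_nhds)).congr' ?_ EventuallyEq.rfl
  filter_upwards [self_mem_nhdsWithin] with ζ hζ
  have hζ1 : ‖ζ / z‖ = 1 := by simpa [hz1] using hζ
  have h := norm_mul_exp_arg_mul_I (ζ / z)
  rw [hζ1, ofReal_one, one_mul] at h
  rw [ofReal_add, add_mul, exp_add, ← hz, h, mul_div_cancel₀ _ hz0]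

/-- Fatou's theorem for bounded analytic functions. -/
theorem ae_exists_hasRadialLimit {f : ℂ → ℂ} (hf : DifferentiableOn ℂ f (ball 0 1)) {M : ℝ≥0}
    (hM : ∀ z ∈ ball (0 : ℂ) 1, ‖f z‖ ≤ M) :
    ∀ᵐ θ : ℝ, ∃ w : ℂ, OPUC.HasRadialLimit f (exp (θ * I)) w := by
  obtain ⟨g, hg⟩ := hf.isExactOn_ball
  have hgL : LipschitzOnWith M g (ball 0 1) :=
    (convex_ball 0 1).lipschitzOnWith_of_nnnorm_hasDerivWithin_le
      (fun z hz => (hg z hz).hasDerivWithinAt) (fun z hz => hM z hz)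
  -- The primitive is Lipschitz because `f` is bounded; its extension supplies boundary values,
  -- differentiable in the angle almost everywhere.
  obtain ⟨G, hGL, hGg⟩ := hgL.extend_finite_dimension
  set K := lipschitzExtensionConstant ℂ * M
  have hdG : ∀ z ∈ ball (0 : ℂ) 1, HasDerivAt G (f z) z := fun z hz =>
    (hg z hz).congr_of_eventuallyEq
      (by filter_upwards [isOpen_ball.mem_nhds hz] with y hy using (hGg hy).symm)
  have hG : DiffContOnCl ℂ G (ball 0 1) :=
    ⟨fun z hz => (hdG z hz).differentiableAt.differentiableWithinAt, hGL.continuous.continuousOn⟩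
  have hlip := hGL.comp (lipschitzWith_circleMap 0 1)
  filter_upwards [hlip.ae_differentiableAt] with θ hθ
  set z : ℂ := exp (θ * I) with hz
  have hz1 : ‖z‖ = 1 := by rw [hz, norm_exp_ofReal_mul_I]
  have hz0 : z ≠ 0 := exp_ne_zero _
  have hγ : HasDerivAt (fun t : ℝ => exp (t * I)) (z * I) θ := by
    have := ((hasDerivAt_id θ).ofReal_comp.mul_const I).cexp
    simpa using this
  have hθ' : HasDerivAt (fun t : ℝ => G (exp (t * I))) (deriv (G ∘ circleMap 0 1) θ) θ := by
    have := hθ.hasDerivAt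
    refine this.congr_of_eventuallyEq ?_
    filter_upwards with t
    simp [circleMap]
  set d := deriv (G ∘ circleMap 0 1) θ
  -- Chosen so that `G` minus its affine part of slope `L` has zero tangential derivative at `z`;
  -- the derivative of that difference inside the disk is `f - L`.
  set L := d / (z * I) with hL
  refine ⟨L, ?_⟩
  set H : ℂ → ℂ := fun ζ => G ζ - G z - L * (ζ - z) with hH
  have hHd : DiffContOnCl ℂ H (ball 0 1) :=
    (hG.sub diffContOnCl_const).sub
      (Differentiable.diffContOnCl (by fun_prop))
  have hbd : ∀ ζ ∈ sphere (0 : ℂ) 1, ‖H ζ‖ ≤ (K + ‖L‖) * ‖ζ - z‖ := by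
    intro ζ _
    have h1 := hGL.norm_sub_le ζ z
    calc ‖H ζ‖ ≤ ‖G ζ - G z‖ + ‖L * (ζ - z)‖ := norm_sub_le _ _
      _ ≤ K * ‖ζ - z‖ + ‖L‖ * ‖ζ - z‖ := by rw [norm_mul]; gcongr
      _ = _ := by ring
  have hHder : HasDerivAt (fun t : ℝ => H (exp (t * I))) 0 θ := by
    have := (hθ'.sub_const (G z)).sub ((hγ.sub_const z).const_mul L)
    have e : d - L * (z * I) = 0 := by
      rw [hL]; field_simp; simp
    rw [e] at this
    exact this
  have hlim := tendsto_deriv_radial_zero hHd hz1 hbd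
    (isLittleO_sphere_of_hasDerivAt hz (by simp [hH]) hHder)
  have hlim2 := hlim.add_const L
  rw [zero_add] at hlim2
  refine hlim2.congr' ?_
  have hpos : ∀ᶠ r : ℝ in 𝓝[<] 1, 0 < r :=
    (tendsto_id.mono_left nhdsWithin_le_nhds).eventually (lt_mem_nhds zero_lt_one)
  filter_upwards [hpos, self_mem_nhdsWithin] with r h0 h1
  have hr : (r * z : ℂ) ∈ ball (0 : ℂ) 1 := by simpa [hz1, abs_of_pos h0] using h1
  have := ((hdG _ hr).sub_const (G z)).sub (((hasDerivAt_id (r * z : ℂ)).sub_const z).const_mul L)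
  have e : deriv H (r * z) = f (r * z) - L * 1 := this.deriv
  rw [e]
  ring

/-! ### Nonvanishing of radial limits, by Jensen's formula -/

/-- In Jensen's formula each zero `u` contributes a nonnegative multiple of `log (R / |c - u|) ≥ 0`.
-/
theorem AnalyticOnNhd.log_norm_center_le_circleAverage {f : ℂ → ℂ} {c : ℂ} {R : ℝ} (hR : 0 < R)
    (hf : AnalyticOnNhd ℂ f (closedBall c R)) (h0 : f c ≠ 0) :
    Real.log ‖f c‖ ≤ Real.circleAverage (fun ζ => Real.log ‖f ζ‖) c R := by
  have hR' : |R| = R := abs_of_pos hR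
  rw [AnalyticOnNhd.circleAverage_log_norm hR.ne' (by rwa [hR']) h0, hR']
  refine le_add_of_nonneg_left (finsum_nonneg fun u => ?_)
  by_cases hu : u ∈ closedBall c R
  · refine mul_nonneg ?_ ?_
    · exact_mod_cast MeromorphicOn.AnalyticOnNhd.divisor_nonneg hf u
    · rcases eq_or_ne u c with rfl | h
      · simp
      · apply Real.log_nonneg
        have h1 : 0 < ‖c - u‖ := norm_pos_iff.mpr (sub_ne_zero.mpr h.symm)
        rw [← div_eq_mul_inv, one_le_div h1]
        simpa [dist_eq_norm, norm_sub_rev] using hu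
  · simp [Function.locallyFinsuppWithin.apply_eq_zero_of_notMem _ hu]

/-- Needed because `Real.log 0 = 0`: an exact zero would hide the divergence of `log ‖f‖`. -/
theorem ae_ne_zero_circleMap {f : ℂ → ℂ} (hf : DifferentiableOn ℂ f (ball 0 1)) (h0 : f 0 ≠ 0)
    {r : ℝ} (hr : 0 < r) (hr1 : r < 1) : ∀ᵐ θ : ℝ, f (circleMap 0 r θ) ≠ 0 := by
  have hsub : closedBall (0 : ℂ) r ⊆ ball 0 1 := closedBall_subset_ball hr1
  have hA : AnalyticOnNhd ℂ f (closedBall 0 r) := (hf.analyticOnNhd isOpen_ball).mono hsub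
  have hfin := (isCompact_closedBall (0 : ℂ) r).finite_sdiff_of_mem_codiscreteWithin
    (hA.preimage_zero_mem_codiscreteWithin h0 (mem_closedBall_self hr.le)
      ⟨⟨0, mem_closedBall_self hr.le⟩, (convex_closedBall 0 r).isPreconnected⟩)
  have hnull := (hfin.countable.preimage_circleMap 0 hr.ne').measure_zero volume
  rw [ae_iff]
  refine measure_mono_null (fun θ hθ => ?_) hnull
  simp only [ne_eq, not_not] at hθ
  exact ⟨circleMap_mem_closedBall 0 hr.le θ, by simpa using hθ⟩

theorem lintegral_log_norm_circleMap_le {f : ℂ → ℂ} (hf : DifferentiableOn ℂ f (ball 0 1))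
    (h0 : f 0 ≠ 0) {M : ℝ} (hM : ∀ z ∈ ball (0 : ℂ) 1, ‖f z‖ ≤ M) (hM1 : 1 ≤ M)
    {r : ℝ} (hr : 0 < r) (hr1 : r < 1) (a : ℝ) :
    ∫⁻ θ in Set.Ioc a (a + 2 * Real.pi),
      ENNReal.ofReal (Real.log M - Real.log ‖f (circleMap 0 r θ)‖) ≤
      ENNReal.ofReal (2 * Real.pi * (Real.log M - Real.log ‖f 0‖)) := by
  have hsub : closedBall (0 : ℂ) r ⊆ ball 0 1 := closedBall_subset_ball hr1
  have hA : AnalyticOnNhd ℂ f (closedBall 0 r) := (hf.analyticOnNhd isOpen_ball).mono hsub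
  have hA' : AnalyticOnNhd ℂ f (sphere 0 |r|) :=
    hA.mono (by rw [abs_of_pos hr]; exact sphere_subset_closedBall)
  have hci : CircleIntegrable (fun ζ => Real.log ‖f ζ‖) 0 r :=
    hA'.meromorphicOn.circleIntegrable_log_norm
  have hper : Function.Periodic (fun θ => Real.log ‖f (circleMap 0 r θ)‖) (2 * Real.pi) :=
    fun θ => by simp only [periodic_circleMap 0 r θ]
  have hle : a ≤ a + 2 * Real.pi := by linarith [Real.two_pi_pos]
  have hI : IntervalIntegrable (fun θ => Real.log ‖f (circleMap 0 r θ)‖) volume a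
      (a + 2 * Real.pi) :=
    hper.intervalIntegrable₀ Real.two_pi_pos.ne' hci a (a + 2 * Real.pi)
  have hI2 := (intervalIntegrable_const (c := Real.log M) (μ := volume) (a := a)
    (b := a + 2 * Real.pi)).sub hI
  have hnn : ∀ θ, 0 ≤ Real.log M - Real.log ‖f (circleMap 0 r θ)‖ := by
    intro θ
    have hm := hM _ (hsub (circleMap_mem_closedBall 0 hr.le θ))
    rw [sub_nonneg]
    rcases (norm_nonneg (f (circleMap 0 r θ))).eq_or_lt with h | h
    · rw [← h, Real.log_zero]; exact Real.log_nonneg hM1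
    · exact Real.log_le_log h hm
  rw [← ofReal_integral_eq_lintegral_ofReal ((intervalIntegrable_iff_integrableOn_Ioc_of_le hle).mp hI2)
    (ae_of_all _ hnn), ← intervalIntegral.integral_of_le hle]
  apply ENNReal.ofReal_le_ofReal
  rw [intervalIntegral.integral_sub intervalIntegrable_const hI, intervalIntegral.integral_const,
    hper.intervalIntegral_add_eq a 0, zero_add]
  have hJ := hA.log_norm_center_le_circleAverage hr h0
  rw [Real.circleAverage_def, smul_eq_mul, inv_mul_eq_div, le_div_iff₀ Real.two_pi_pos] at hJ
  simp only [smul_eq_mul]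
  linarith

/-- Radial limits of a bounded analytic function that does not vanish at the origin
are almost everywhere nonzero. -/
theorem ae_not_hasRadialLimit_zero {f : ℂ → ℂ} (hf : DifferentiableOn ℂ f (ball 0 1))
    (h0 : f 0 ≠ 0) {M : ℝ} (hM : ∀ z ∈ ball (0 : ℂ) 1, ‖f z‖ ≤ M) :
    ∀ᵐ θ : ℝ, ¬ OPUC.HasRadialLimit f (exp (θ * I)) 0 := by
  wlog hM1 : 1 ≤ M generalizing M
  · exact this (fun z hz => (hM z hz).trans (le_max_left M 1)) (le_max_right M 1)
  obtain ⟨r, -, hr, hrt⟩ := exists_seq_strictMono_tendsto' (zero_lt_one (α := ℝ))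
  set φ : ℕ → ℝ → ENNReal := fun n θ =>
    ENNReal.ofReal (Real.log M - Real.log ‖f (circleMap 0 (r n) θ)‖) with hφ
  have hmeas : ∀ n, Measurable (φ n) := by
    intro n
    have hc : Continuous fun θ => f (circleMap 0 (r n) θ) :=
      hf.continuousOn.comp_continuous (continuous_circleMap 0 _) fun θ =>
        closedBall_subset_ball (hr n).2 (circleMap_mem_closedBall 0 (hr n).1.le θ)
    exact (measurable_const.sub (Real.measurable_log.comp hc.norm.measurable)).ennreal_ofReal
  have hne : ∀ᵐ θ : ℝ, ∀ n, f (circleMap 0 (r n) θ) ≠ 0 :=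
    ae_all_iff.mpr fun n => ae_ne_zero_circleMap hf h0 (hr n).1 (hr n).2
  -- Fatou's lemma, with the Jensen bound uniform in the radius.
  have hloc : ∀ a : ℝ, ∀ᵐ θ ∂(volume.restrict (Set.Ioc a (a + 2 * Real.pi))),
      liminf (fun n => φ n θ) atTop < ⊤ := by
    intro a
    refine ae_lt_top (.liminf hmeas) (ne_top_of_le_ne_top
      (b := ENNReal.ofReal (2 * Real.pi * (Real.log M - Real.log ‖f 0‖))) ENNReal.ofReal_ne_top ?_)
    refine (lintegral_liminf_le hmeas).trans ?_
    refine liminf_le_of_le (by isBoundedDefault) fun b hb => ?_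
    obtain ⟨n, hn⟩ := hb.exists
    exact hn.trans (lintegral_log_norm_circleMap_le hf h0 hM hM1 (hr n).1 (hr n).2 a)
  have hglob : ∀ᵐ θ : ℝ, liminf (fun n => φ n θ) atTop < ⊤ := by
    have := (ae_restrict_iUnion_iff (fun k : ℤ => Set.Ioc (0 + k • (2 * Real.pi))
      (0 + (k + 1) • (2 * Real.pi))) _).mpr fun k => by
        have := hloc (0 + k • (2 * Real.pi))
        rwa [show (0 : ℝ) + k • (2 * Real.pi) + 2 * Real.pi = 0 + (k + 1) • (2 * Real.pi) by
          rw [add_smul, one_smul, add_assoc]] at this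
    rwa [iUnion_Ioc_add_zsmul Real.two_pi_pos, Measure.restrict_univ] at this
  filter_upwards [hne, hglob] with θ hθ hlt hlim
  have hrt' : Tendsto r atTop (𝓝[<] 1) :=
    tendsto_nhdsWithin_iff.mpr ⟨hrt, Eventually.of_forall fun n => (hr n).2⟩
  have hlim' : Tendsto (fun n => ‖f (circleMap 0 (r n) θ)‖) atTop (𝓝[>] 0) := by
    refine tendsto_nhdsWithin_iff.mpr ⟨?_, Eventually.of_forall fun n => norm_pos_iff.mpr (hθ n)⟩
    have := (Tendsto.comp hlim hrt').norm
    simpa [circleMap, Function.comp_def] using this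
  have hlog := Real.tendsto_log_nhdsGT_zero.comp hlim'
  -- A zero radial limit forces `φ n θ → ∞`, against the finite liminf.
  have hφt : Tendsto (fun n => φ n θ) atTop (𝓝 ⊤) :=
    ENNReal.tendsto_ofReal_atTop.comp
      (tendsto_atTop_add_const_left _ (Real.log M) (tendsto_neg_atBot_atTop.comp hlog))
  exact hlt.ne hφt.liminf_eq

end BoundaryValues

/-! ### Szegő and Wall polynomials -/

namespace OPUC

theorem natDegree_revPoly_le {n : ℕ} {P : ℂ[X]} (hP : P.natDegree ≤ n) :
    (revPoly n P).natDegree ≤ n :=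
  natDegree_reflect_le.trans (max_le le_rfl (natDegree_map_le.trans hP))

theorem revPoly_add (n : ℕ) (P Q : ℂ[X]) : revPoly n (P + Q) = revPoly n P + revPoly n Q := by
  simp [revPoly, reflect_add]

theorem revPoly_sub (n : ℕ) (P Q : ℂ[X]) : revPoly n (P - Q) = revPoly n P - revPoly n Q := by
  simp [revPoly, reflect_sub]

theorem revPoly_C_mul (n : ℕ) (c : ℂ) (P : ℂ[X]) :
    revPoly n (C c * P) = C (starRingEnd ℂ c) * revPoly n P := by
  simp [revPoly, reflect_C_mul]

theorem revPoly_revPoly (n : ℕ) (P : ℂ[X]) : revPoly n (revPoly n P) = P := by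
  rw [revPoly, revPoly, ← reflect_map, Polynomial.map_map, reflect_reflect]
  ext
  simp

theorem revPoly_succ {n : ℕ} {P : ℂ[X]} (hP : P.natDegree ≤ n) :
    revPoly (n + 1) P = X * revPoly n P := by
  have := reflect_mul (1 : ℂ[X]) (P.map (starRingEnd ℂ)) (F := 1) (G := n) (by simp)
    (natDegree_map_le.trans hP)
  rwa [one_mul, reflect_one, pow_one, add_comm] at this

theorem revPoly_succ_X_mul {n : ℕ} {P : ℂ[X]} (hP : P.natDegree ≤ n) :
    revPoly (n + 1) (X * P) = revPoly n P := by
  have := reflect_mul (X : ℂ[X]) (P.map (starRingEnd ℂ)) (F := 1) (G := n) (by simp)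
    (natDegree_map_le.trans hP)
  rw [reflect_one_X, one_mul, add_comm] at this
  rw [revPoly, Polynomial.map_mul, map_X, this, revPoly]

theorem eval_revPoly {n : ℕ} {P : ℂ[X]} (hP : P.natDegree ≤ n) {z : ℂ} (hz : ‖z‖ = 1) :
    (revPoly n P).eval z = z ^ n * starRingEnd ℂ (P.eval z) := by
  have hz0 : z ≠ 0 := norm_pos_iff.mp (by rw [hz]; exact one_pos)
  have hinv : z⁻¹ = starRingEnd ℂ z := Complex.inv_eq_conj hz
  let _ := invertibleOfNonzero (inv_ne_zero hz0)
  have h := eval₂_reflect_mul_pow (RingHom.id ℂ) z⁻¹ n (P.map (starRingEnd ℂ))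
    (natDegree_map_le.trans hP)
  rw [invOf_eq_inv, inv_inv] at h
  change (revPoly n P).eval z * z⁻¹ ^ n = (P.map (starRingEnd ℂ)).eval z⁻¹ at h
  rw [hinv, eval_map, eval₂_at_apply, ← hinv] at h
  rw [← h, inv_pow]
  field_simp

theorem wallA_succ (α : ℕ → ℂ) (n : ℕ) :
    wallA α (n + 1) = wallA α n + C (α (n + 1)) * (X * revPoly n (wallB α n)) := by
  rw [← mul_assoc]; rfl

theorem wallB_succ (α : ℕ → ℂ) (n : ℕ) :
    wallB α (n + 1) = wallB α n + C (α (n + 1)) * (X * revPoly n (wallA α n)) := by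
  rw [← mul_assoc]; rfl

theorem natDegree_add_C_mul_X_mul_revPoly_le {n : ℕ} {P Q : ℂ[X]} (hP : P.natDegree ≤ n)
    (hQ : Q.natDegree ≤ n) (c : ℂ) : (P + C c * (X * revPoly n Q)).natDegree ≤ n + 1 := by
  refine natDegree_add_le_of_degree_le (hP.trans n.le_succ) ((natDegree_C_mul_le _ _).trans ?_)
  refine natDegree_mul_le.trans ?_
  have := natDegree_revPoly_le hQ
  have := natDegree_X_le (R := ℂ)
  omega

theorem natDegree_wall_le (α : ℕ → ℂ) (n : ℕ) :
    (wallA α n).natDegree ≤ n ∧ (wallB α n).natDegree ≤ n := by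
  induction n with
  | zero => simp [wallA, wallB, wall]
  | succ n ih =>
    rw [wallA_succ, wallB_succ]
    exact ⟨natDegree_add_C_mul_X_mul_revPoly_le ih.1 ih.2 _,
      natDegree_add_C_mul_X_mul_revPoly_le ih.2 ih.1 _⟩

/-- Stated conditionally so that the induction for `Phi_succ_eq` can use it at each step. -/
theorem revPoly_Phi_succ_of_eq {α : ℕ → ℂ} {n : ℕ}
    (h : Phi α (n + 1) = X * revPoly n (wallB α n) - revPoly n (wallA α n)) :
    revPoly (n + 1) (Phi α (n + 1)) = wallB α n - X * wallA α n := by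
  obtain ⟨hA, hB⟩ := natDegree_wall_le α n
  rw [h, revPoly_sub, revPoly_succ_X_mul (natDegree_revPoly_le hB),
    revPoly_succ (natDegree_revPoly_le hA), revPoly_revPoly, revPoly_revPoly]

theorem Phi_succ_eq (α : ℕ → ℂ) (n : ℕ) :
    Phi α (n + 1) = X * revPoly n (wallB α n) - revPoly n (wallA α n) := by
  induction n with
  | zero => simp [Phi, wallA, wallB, wall, revPoly]
  | succ n ih =>
    obtain ⟨hA, hB⟩ := natDegree_wall_le α n
    rw [Phi, revPoly_Phi_succ_of_eq ih, ih, wallA_succ, wallB_succ, revPoly_add, revPoly_add,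
      revPoly_C_mul, revPoly_C_mul, revPoly_succ hA, revPoly_succ hB,
      revPoly_succ_X_mul (natDegree_revPoly_le hA), revPoly_succ_X_mul (natDegree_revPoly_le hB),
      revPoly_revPoly, revPoly_revPoly]
    ring

theorem revPoly_Phi_succ (α : ℕ → ℂ) (n : ℕ) :
    revPoly (n + 1) (Phi α (n + 1)) = wallB α n - X * wallA α n :=
  revPoly_Phi_succ_of_eq (Phi_succ_eq α n)

theorem eval_zero_wallB (α : ℕ → ℂ) (n : ℕ) : (wallB α n).eval 0 = 1 := by
  induction n with
  | zero => simp [wallB, wall]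
  | succ n ih => rw [wallB_succ]; simp [ih]

/-- The cross terms cancel because `|u| = 1`. It serves twice: with `c = α_{n+1}` in the induction
for `ω_n`, and with `c` the boundary value of `f_N`, which acts as one further coefficient. -/
theorem norm_sq_add_sub_norm_sq_add (a b c : ℂ) {u : ℂ} (hu : ‖u‖ = 1) :
    ‖b + c * (u * starRingEnd ℂ a)‖ ^ 2 - ‖a + c * (u * starRingEnd ℂ b)‖ ^ 2 =
      (1 - ‖c‖ ^ 2) * (‖b‖ ^ 2 - ‖a‖ ^ 2) := by
  have h : u * starRingEnd ℂ u = 1 := by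
    rw [Complex.mul_conj, Complex.normSq_eq_norm_sq, hu]; simp
  rw [← Complex.ofReal_inj]
  push_cast
  simp only [← Complex.mul_conj', map_add, map_mul, Complex.conj_conj]
  linear_combination c * starRingEnd ℂ c * (a * starRingEnd ℂ a - b * starRingEnd ℂ b) * h

theorem norm_sq_wallB_sub_norm_sq_wallA (α : ℕ → ℂ) (n : ℕ) {z : ℂ} (hz : ‖z‖ = 1) :
    ‖(wallB α n).eval z‖ ^ 2 - ‖(wallA α n).eval z‖ ^ 2 = omega α n := by
  induction n with
  | zero => simp [wallA, wallB, wall, omega]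
  | succ n ih =>
    obtain ⟨hA, hB⟩ := natDegree_wall_le α n
    have := norm_sq_add_sub_norm_sq_add ((wallA α n).eval z) ((wallB α n).eval z) (α (n + 1))
      -- On the circle `z P^*(z) = z * z ^ n * conj (P z)`.
      (u := z * z ^ n) (by simp [hz])
    rw [ih] at this
    rw [omega, Finset.prod_range_succ, ← omega, wallA_succ, wallB_succ, mul_comm (omega α n), ← this]
    simp only [eval_add, eval_mul, eval_C, eval_X, eval_revPoly hA hz, eval_revPoly hB hz, mul_assoc]

theorem norm_sq_wall_sub_norm_sq_wall (α : ℕ → ℂ) (n : ℕ) {z : ℂ} (hz : ‖z‖ = 1) (w : ℂ) :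
    ‖(wallB α n).eval z + z * (revPoly n (wallA α n)).eval z * w‖ ^ 2 -
      ‖(wallA α n).eval z + z * (revPoly n (wallB α n)).eval z * w‖ ^ 2 =
      omega α n * (1 - ‖w‖ ^ 2) := by
  obtain ⟨hA, hB⟩ := natDegree_wall_le α n
  have := norm_sq_add_sub_norm_sq_add ((wallA α n).eval z) ((wallB α n).eval z) w
    (u := z * z ^ n) (by simp [hz])
  rw [norm_sq_wallB_sub_norm_sq_wallA α n hz] at this
  rw [eval_revPoly hA hz, eval_revPoly hB hz, mul_comm (omega α n), ← this]
  ring_nf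

/-- The real part of the Herglotz–Riesz kernel is the Poisson kernel. -/
theorem re_add_div_sub (x y : ℂ) : ((x + y) / (x - y)).re = (‖x‖ ^ 2 - ‖y‖ ^ 2) / ‖x - y‖ ^ 2 := by
  have := congrFun (poissonKernel_eq_re_herglotzRieszKernel (c := 0) (w := y)) x
  simpa [poissonKernel_def, herglotzRieszKernel_def] using this.symm

theorem exists_norm_eval_le (P : ℂ[X]) :
    ∃ M : ℝ, ∀ z ∈ Metric.ball (0 : ℂ) 1, ‖P.eval z‖ ≤ M := by
  obtain ⟨M, hM⟩ := (isCompact_closedBall (0 : ℂ) 1).exists_bound_of_continuousOn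
    P.continuous.continuousOn
  exact ⟨M, fun z hz => hM z (Metric.ball_subset_closedBall hz)⟩

theorem HasRadialLimit.eval_add_eval_mul {f : ℂ → ℂ} {z w : ℂ} (hf : HasRadialLimit f z w)
    (P Q : ℂ[X]) :
    HasRadialLimit (fun y => P.eval y + y * Q.eval y * f y) z
      (P.eval z + z * Q.eval z * w) := by
  have hr : Filter.Tendsto (fun r : ℝ => (r : ℂ) * z) (nhdsWithin 1 (Set.Iio 1)) (nhds z) := by
    have h : Continuous fun r : ℝ => (r : ℂ) * z := by fun_prop
    have := h.tendsto 1
    rw [Complex.ofReal_one, one_mul] at this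
    exact this.mono_left nhdsWithin_le_nhds
  have hP : ∀ P : ℂ[X], Filter.Tendsto (fun r : ℝ => P.eval ((r : ℂ) * z))
      (nhdsWithin 1 (Set.Iio 1)) (nhds (P.eval z)) := fun P => (P.continuous.tendsto z).comp hr
  exact (hP P).add ((hr.mul (hP Q)).mul hf)

theorem HasRadialLimit.id (z : ℂ) : HasRadialLimit (fun y => y) z z := by
  simpa using HasRadialLimit.eval_add_eval_mul (f := 0) (z := z) (w := 0) tendsto_const_nhds X 0

theorem ae_eval_add_eval_mul_ne_zero {f : ℂ → ℂ} (hf : IsSchur f) {P : ℂ[X]} (hP : P.eval 0 ≠ 0)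
    (Q : ℂ[X]) :
    ∀ᵐ θ : ℝ, ∀ w : ℂ, HasRadialLimit f (Complex.exp (θ * Complex.I)) w →
      P.eval (Complex.exp (θ * Complex.I)) +
        Complex.exp (θ * Complex.I) * Q.eval (Complex.exp (θ * Complex.I)) * w ≠ 0 := by
  obtain ⟨M, hM⟩ := exists_norm_eval_le P
  obtain ⟨M', hM'⟩ := exists_norm_eval_le (X * Q)
  have hd : DifferentiableOn ℂ (fun y => P.eval y + y * Q.eval y * f y) (Metric.ball 0 1) :=
    P.differentiable.differentiableOn.add
      ((differentiableOn_id.mul Q.differentiable.differentiableOn).mul hf.1)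
  have hb : ∀ y ∈ Metric.ball (0 : ℂ) 1, ‖P.eval y + y * Q.eval y * f y‖ ≤ M + M' * 1 := by
    intro y hy
    refine (norm_add_le _ _).trans (add_le_add (hM y hy) ?_)
    rw [norm_mul]
    have h := hM' y hy
    rw [eval_mul, eval_X] at h
    exact mul_le_mul h (hf.2 y hy) (norm_nonneg _) ((norm_nonneg _).trans h)
  filter_upwards [ae_not_hasRadialLimit_zero hd (by simpa using hP) hb] with θ hθ w hw h0
  exact hθ (h0 ▸ hw.eval_add_eval_mul P Q)

end OPUC

/-! ### The boundary formula for the real part of `F` -/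

theorem proposition1 (α : ℕ → ℂ) (N : ℕ) (hN : 1 ≤ N)
    (hlt : ∀ n, n < N → ‖α n‖ ≠ 1) (hge : ∀ n, N ≤ n → ‖α n‖ < 1)
    (fN : ℂ → ℂ) (hfN : OPUC.IsSchurFunctionOf (fun n => α (N + n)) fN) :
    ∀ᵐ θ : ℝ, ∀ z : ℂ, z = Complex.exp (θ * Complex.I) →
      ∃ w L : ℂ,
        OPUC.HasRadialLimit fN z w ∧
        OPUC.HasRadialLimit (OPUC.caratheodory (OPUC.wallRepr α N fN)) z L ∧
        (OPUC.revPoly N (OPUC.Phi α N)).eval z - z * (OPUC.Phi α N).eval z * w ≠ 0 ∧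
        L.re = OPUC.omega α (N - 1) * ((1 - ‖w‖ ^ 2) /
          ‖(OPUC.revPoly N (OPUC.Phi α N)).eval z - z * (OPUC.Phi α N).eval z * w‖ ^ 2) := by
  obtain ⟨n, rfl⟩ : ∃ n, N = n + 1 := ⟨N - 1, by omega⟩
  have hS : OPUC.IsSchur fN := by
    obtain ⟨g, rfl, hg, -⟩ := hfN
    exact hg 0
  have hB0 : (OPUC.wallB α n).eval 0 ≠ 0 := by rw [OPUC.eval_zero_wallB]; exact one_ne_zero
  have hP0 : (OPUC.revPoly (n + 1) (OPUC.Phi α (n + 1))).eval 0 ≠ 0 := by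
    rw [OPUC.revPoly_Phi_succ]
    simp [OPUC.eval_zero_wallB]
  -- The two nonvanishing statements concern `D` and `Φ_N^* - z Φ_N f_N`; the minus sign is put into
  -- `-Phi`.
  filter_upwards [ae_exists_hasRadialLimit hS.1 (M := 1) (by simpa using hS.2),
    OPUC.ae_eval_add_eval_mul_ne_zero hS hB0 (OPUC.revPoly n (OPUC.wallA α n)),
    OPUC.ae_eval_add_eval_mul_ne_zero hS hP0 (-OPUC.Phi α (n + 1))] with θ hlim hD hΦ z hz
  rw [← hz] at hlim hD hΦ
  obtain ⟨w, hw⟩ := hlim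
  have hz1 : ‖z‖ = 1 := by rw [hz, Complex.norm_exp_ofReal_mul_I]
  replace hΦ := hΦ w hw
  replace hD := hD w hw
  rw [eval_neg, mul_neg, neg_mul, ← sub_eq_add_neg] at hΦ
  set D := (OPUC.wallB α n).eval z + z * (OPUC.revPoly n (OPUC.wallA α n)).eval z * w with hDdef
  set A := (OPUC.wallA α n).eval z + z * (OPUC.revPoly n (OPUC.wallB α n)).eval z * w with hAdef
  have hΦeq : (OPUC.revPoly (n + 1) (OPUC.Phi α (n + 1))).eval z -
      z * (OPUC.Phi α (n + 1)).eval z * w = D - z * A := by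
    rw [OPUC.revPoly_Phi_succ, OPUC.Phi_succ_eq, hDdef, hAdef]
    simp only [eval_sub, eval_mul, eval_X]
    ring
  rw [hΦeq] at hΦ
  have hne : 1 - z * (A / D) ≠ 0 := by
    rw [← mul_div_assoc, one_sub_div hD]
    exact div_ne_zero hΦ hD
  have hf : OPUC.HasRadialLimit (OPUC.wallRepr α (n + 1) fN) z (A / D) :=
    Filter.Tendsto.div (hw.eval_add_eval_mul _ _) (hw.eval_add_eval_mul _ _) hD
  have hzf := (OPUC.HasRadialLimit.id z).mul hf
  refine ⟨w, (1 + z * (A / D)) / (1 - z * (A / D)), hw, ?_, by rwa [hΦeq], ?_⟩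
  · exact (hzf.const_add 1).div (hzf.const_sub 1) hne
  · rw [hΦeq, ← mul_div_assoc, one_add_div hD, one_sub_div hD, div_div_div_cancel_right₀ hD,
      OPUC.re_add_div_sub, norm_mul, hz1, one_mul, hDdef, hAdef,
      OPUC.norm_sq_wall_sub_norm_sq_wall α n hz1, Nat.add_sub_cancel, mul_div_assoc]
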